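/- Let $T>0$, $n\ge 3$ and $Q\ge 1$. A parameter $\theta=(\pi,\alpha)$ consists of probabilities $\pi_1,\dots,\pi_Q>0$ with $\sum_q\pi_q=1$ and of intensities $\alpha^{(q,l)}:[0,T]\to[0,\infty)$, integrable on $[0,T]$ $(q,l=1,\dots,Q)$; in the undirected setup $\alpha^{(q,l)}=\alpha^{(l,q)}$ is required in addition. Let $\mathcal R=\{(i,j): 1\le i,j\le n,\ i\ne j\}$ in the directed setup and $\mathcal R=\{(i,j): 1\le i<j\le n\}$ in the undirected setup. In the Poisson process stochastic block model with parameter $\theta$, the latent labels $Z_1,\dots,Z_n$ are independent with $\mathrm{pr}(Z_i=q)=\pi_q$, and conditionally on $(Z_1,\dots,Z_n)$ the counting processes $N_{i,j}$, $(i,j)\in\mathcal R$, are independent inhomogeneous Poisson processes on $[0,T]$, $N_{i,j}$ having intensity $\alpha^{(Z_i,Z_j)}$. Let $\mathrm{pr}_\theta$ be the distribution of $\{N_{i,j}(t): 0\le t\le T\}_{(i,j)\in\mathcal R}$. Let $\theta=(\pi,\alpha)$ be a parameter such that no two of the $Q^2$ intensities $\alpha^{(q,l)}$, $1\le q,l\le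 Q$ (directed setup), respectively no two of the $Q(Q+1)/2$ intensities $\alpha^{(q,l)}$, $1\le q\le l\le Q$ (undirected setup), are equal almost everywhere on $[0,T]$. Then $\theta$ is identifiable on $[0,T]$ up to label switching: in either setup, if $\tilde\theta=(\tilde\pi,\tilde\alpha)$ is any parameter of that setup with the same number $Q$ of groups and $\mathrm{pr}_\theta=\mathrm{pr}_{\tilde\theta}$, then there is a permutation $\sigma$ of $\{1,\dots,Q\}$ such that, for all $q,l=1,\dots,Q$, $$\pi_q=\tilde\pi_{\sigma(q)},\qquad \alpha^{(q,l)}=\tilde\alpha^{(\sigma(q),\sigma(l))}\ \text{ almost everywhere on } [0,T].$$ -/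

import Mathlib

open MeasureTheory ProbabilityTheory Filter Topology

namespace PPSBM

/-- A parameter `θ = (π, α)` with `Q` groups on the time interval `[0,T]`: non-zero group
probabilities `π_q` and intensities `α^{(q,l)}`, non-negative and integrable on `[0,T]`
(only the values of `α q l` on `[0,T]` matter). -/
structure Param (Q : ℕ) (T : ℝ) where
  /-- the group proportions -/
  π : Fin Q → ℝ
  /-- the intensities -/
  α : Fin Q → Fin Q → ℝ → ℝ
  π_pos : ∀ q, 0 < π q
  π_sum : ∑ q, π q = 1
  α_nonneg : ∀ q l, ∀ t ∈ Set.Icc 0 T, 0 ≤ α q l t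
  α_integrable : ∀ q l, IntegrableOn (α q l) (Set.Icc 0 T)

/-- The restriction on the parameter in the undirected setup: `α^{(q,l)} = α^{(l,q)}`. -/
def Param.IsSymm {Q : ℕ} {T : ℝ} (θ : Param Q T) : Prop :=
  ∀ q l, θ.α q l = θ.α l q

/-- Almost everywhere equality on `[0,T]`. -/
def AEEqOn (T : ℝ) (f g : ℝ → ℝ) : Prop :=
  f =ᵐ[volume.restrict (Set.Icc 0 T)] g

/-- The `Q²` intensities are pairwise distinct, i.e. no two are a.e. equal on `[0,T]`. -/
def Param.DistinctDirected {Q : ℕ} {T : ℝ} (θ : Param Q T) : Prop :=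
  ∀ q l q' l', AEEqOn T (θ.α q l) (θ.α q' l') → q = q' ∧ l = l'

/-- The `Q(Q+1)/2` intensities `α^{(q,l)}`, `q ≤ l`, are pairwise distinct, i.e. no two are
a.e. equal on `[0,T]`. -/
def Param.DistinctUndirected {Q : ℕ} {T : ℝ} (θ : Param Q T) : Prop :=
  ∀ q l q' l', q ≤ l → q' ≤ l' → AEEqOn T (θ.α q l) (θ.α q' l') → q = q' ∧ l = l'

/-- The dyads of the directed model without self-interactions. -/
def directedDyads (n : ℕ) : Set (Fin n × Fin n) := {p | p.1 ≠ p.2}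

/-- The dyads of the undirected model without self-interactions, each unordered pair being
represented by its increasing enumeration. -/
def undirectedDyads (n : ℕ) : Set (Fin n × Fin n) := {p | p.1 < p.2}

/-- Paths of counting processes on `[0,T]` without multiple events: started at `0`,
non-decreasing, right-continuous, with jumps of size at most one. -/
structure IsCountingPath {T : ℝ} (x : Set.Icc (0 : ℝ) T → ℕ) : Prop where
  zero : ∀ t : Set.Icc (0 : ℝ) T, (t : ℝ) = 0 → x t = 0
  mono : Monotone x
  right_cont : ∀ t, ContinuousWithinAt x (Set.Ici t) t
  jump_le_one : ∀ t, ∀ᶠ s in 𝓝[<] t, x t ≤ x s + 1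

/-- `N` is, under `P`, an inhomogeneous Poisson process on `[0,T]` with intensity `a`: a counting
process with independent increments, `N_t - N_s` being Poisson distributed with mean
`∫_s^t a(u) du`. (The truncated subtraction in `ℕ` is harmless as the paths are monotone.) -/
structure IsPoissonProcess {Ω : Type*} [MeasurableSpace Ω] {T : ℝ} (P : Measure Ω)
    (N : Set.Icc (0 : ℝ) T → Ω → ℕ) (a : ℝ → ℝ) : Prop where
  measurable : ∀ t, Measurable (N t)
  path : ∀ᵐ ω ∂P, IsCountingPath (fun t => N t ω)
  indep_increments : HasIndepIncrements N P
  law_increment : ∀ s t : Set.Icc (0 : ℝ) T, s ≤ t →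
    P.map (N t - N s) = poissonMeasure (∫ u in (s : ℝ)..(t : ℝ), a u).toNNReal

/-- `(Z, N)` is, under `P`, a Poisson process stochastic block model with parameter `θ`, for `n`
individuals and the set `R` of dyads: the group labels `Z_1, …, Z_n` are i.i.d. with
`P(Z_i = q) = π_q`, and, conditionally on `Z = z`, the processes `N_{i,j}`, `(i,j) ∈ R`, are
independent inhomogeneous Poisson processes, `N_{i,j}` having intensity `α^{(z_i, z_j)}`. -/
structure IsModel {Q n : ℕ} {T : ℝ} (R : Set (Fin n × Fin n)) (θ : Param Q T)
    {Ω : Type*} [MeasurableSpace Ω] (P : Measure Ω)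
    (Z : Fin n → Ω → Fin Q) (N : R → Set.Icc (0 : ℝ) T → Ω → ℕ) : Prop where
  measurable_Z : ∀ i, Measurable (Z i)
  measurable_N : ∀ r t, Measurable (N r t)
  indep_Z : iIndepFun Z P
  law_Z : ∀ i q, P.real {ω | Z i ω = q} = θ.π q
  cond_indep : ∀ z : Fin n → Fin Q,
    iIndepFun (fun r ω t => N r t ω) (P[|{ω | ∀ i, Z i ω = z i}])
  cond_poisson : ∀ (z : Fin n → Fin Q) (r : R),
    IsPoissonProcess (P[|{ω | ∀ i, Z i ω = z i}]) (N r) (θ.α (z r.1.1) (z r.1.2))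

/-- The distribution of the multivariate counting process `(N_r)_{r ∈ R}` on `[0,T]`, on the path
space with its product `σ`-algebra. -/
noncomputable def processLaw {n : ℕ} {T : ℝ} {R : Set (Fin n × Fin n)}
    {Ω : Type*} [MeasurableSpace Ω] (P : Measure Ω)
    (N : R → Set.Icc (0 : ℝ) T → Ω → ℕ) : Measure (R → Set.Icc (0 : ℝ) T → ℕ) :=
  P.map (fun ω r t => N r t ω)

/-- The parameters `θ` and `θ'` agree up to label switching: for some permutation `σ` of the
groups, `π_q = π'_{σ(q)}` and `α^{(q,l)} = α'^{(σ(q),σ(l))}` almost everywhere on `[0,T]`. -/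
def EqUpToLabelSwitching {Q : ℕ} {T : ℝ} (θ θ' : Param Q T) : Prop :=
  ∃ σ : Equiv.Perm (Fin Q), (∀ q, θ.π q = θ'.π (σ q)) ∧
    ∀ q l, AEEqOn T (θ.α q l) (θ'.α (σ q) (σ l))

/-- `θ` is identifiable up to label switching, among the parameters in the class `C`, from the
distribution of the multivariate counting process indexed by the dyads in `R`: whenever a model
with parameter `θ` and a model with parameter `θ' ∈ C` give the same distribution, `θ` and `θ'`
agree up to label switching. -/
def Identifiable.{u, v} {Q n : ℕ} {T : ℝ} (R : Set (Fin n × Fin n)) (C : Set (Param Q T))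
    (θ : Param Q T) : Prop :=
  ∀ θ' ∈ C, ∀ (Ω : Type u) (Ω' : Type v) [MeasurableSpace Ω] [MeasurableSpace Ω']
    (P : Measure Ω) (P' : Measure Ω') [IsProbabilityMeasure P] [IsProbabilityMeasure P']
    (Z : Fin n → Ω → Fin Q) (Z' : Fin n → Ω' → Fin Q)
    (N : R → Set.Icc (0 : ℝ) T → Ω → ℕ) (N' : R → Set.Icc (0 : ℝ) T → Ω' → ℕ),
    IsModel R θ P Z N → IsModel R θ' P' Z' N' →
    processLaw P N = processLaw P' N' → EqUpToLabelSwitching θ θ'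

end PPSBM

/-! Conditionally on the labels, the increments along a time grid are independent Poisson variables,
and a Poisson variable of mean `r` gives `(1 + w) ^ N` the expectation `exp (w * r)`. For natural
`w` the law of the increments is thus encoded by a finite mixture of characters `w ↦ exp (∑ w v)`.
Distinct characters are linearly independent, so the law determines the mixing measure, that is, the
joint distribution of the mean increments over the dyads (`IsModel.sameConnectionLaw`). A finite
grid suffices to separate the finitely many intensities of both parameters
(`exists_separating_grid`).

What remains is combinatorial (`SameConnectionLaw.exists_perm`). Counting values shows that the
intensities of the second parameter also determine unordered pairs of labels. Three individuals with
a common label then reveal which intensities are diagonal, which defines `σ`; two labels spread over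
three individuals give the off-diagonal intensities, and the event that all labels equal `q` has
probability `π q ^ n`. -/

namespace PPSBM

/-! ### Separation of intensities by finitely many increments -/

/-- Integrable functions on `[0,T]` with the same primitive are almost everywhere equal. -/
lemma aeEqOn_of_forall_integral_eq {T : ℝ} (hT : 0 ≤ T) {f g : ℝ → ℝ}
    (hf : IntegrableOn f (Set.Icc 0 T)) (hg : IntegrableOn g (Set.Icc 0 T))
    (h : ∀ t ∈ Set.Icc 0 T, ∫ u in (0 : ℝ)..t, f u = ∫ u in (0 : ℝ)..t, g u) :
    AEEqOn T f g := by
  have hf' : IntervalIntegrable f volume 0 T :=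
    (intervalIntegrable_iff_integrableOn_Icc_of_le hT).2 hf
  have hg' : IntervalIntegrable g volume 0 T :=
    (intervalIntegrable_iff_integrableOn_Icc_of_le hT).2 hg
  -- Away from the endpoints `[0,T]` is a neighbourhood of `x`, so the primitives agree near `x` and
  -- have the same derivative.
  have h₀ : ∀ᵐ x : ℝ, x ≠ 0 := by simp [ae_iff, measure_singleton]
  have h₁ : ∀ᵐ x : ℝ, x ≠ T := by simp [ae_iff, measure_singleton]
  refine (ae_restrict_iff' measurableSet_Icc).2 ?_
  filter_upwards [hf'.ae_hasDerivAt_integral, hg'.ae_hasDerivAt_integral, h₀, h₁]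
    with x hfx hgx hx₀ hx₁ hx
  rw [Set.uIcc_of_le hT] at hfx hgx
  have hx' : Set.Icc 0 T ∈ 𝓝 x :=
    Icc_mem_nhds (lt_of_le_of_ne hx.1 hx₀.symm) (lt_of_le_of_ne hx.2 hx₁)
  refine ((hfx hx 0 ⟨le_rfl, hT⟩).congr_of_eventuallyEq ?_).unique (hgx hx 0 ⟨le_rfl, hT⟩)
  filter_upwards [hx'] with y hy using (h y hy).symm

/-- The integrals of `a` over the successive intervals of the grid `t`. -/
noncomputable def increments {T : ℝ} {m : ℕ} (t : Fin (m + 1) → Set.Icc (0 : ℝ) T) (a : ℝ → ℝ)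
    (k : Fin m) : ℝ :=
  ∫ u in (t k.castSucc : ℝ)..(t k.succ : ℝ), a u

/-- Finitely many integrable functions on `[0,T]` are separated, up to almost everywhere equality,
by their increments along some finite grid. -/
lemma exists_separating_grid {T : ℝ} (hT : 0 ≤ T) {K : Type*} [Finite K] (f : K → ℝ → ℝ)
    (hf : ∀ i, IntegrableOn (f i) (Set.Icc 0 T)) :
    ∃ (m : ℕ) (t : Fin (m + 1) → Set.Icc (0 : ℝ) T), Monotone t ∧
      ∀ i j, increments t (f i) = increments t (f j) → AEEqOn T (f i) (f j) := by
  classical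
  cases nonempty_fintype K
  have hsep : ∀ p : K × K, ∃ s : Set.Icc (0 : ℝ) T,
      ∫ u in (0 : ℝ)..s, f p.1 u = ∫ u in (0 : ℝ)..s, f p.2 u → AEEqOn T (f p.1) (f p.2) := by
    intro p
    by_contra! hp
    exact (hp ⟨0, le_rfl, hT⟩).2
      (aeEqOn_of_forall_integral_eq hT (hf _) (hf _) fun t ht => (hp ⟨t, ht⟩).1)
  choose s hs using hsep
  let zero : Set.Icc (0 : ℝ) T := ⟨0, le_rfl, hT⟩
  -- Including `0` anchors the primitives: equal increments only make their difference constant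
  -- along the grid.
  let S : Finset (Set.Icc (0 : ℝ) T) := insert zero (Finset.univ.image s)
  obtain ⟨m, hm⟩ : ∃ m, S.card = m + 1 :=
    Nat.exists_eq_succ_of_ne_zero (Finset.card_ne_zero_of_mem (Finset.mem_insert_self _ _))
  let t := S.orderEmbOfFin hm
  have hrange : ∀ x ∈ S, ∃ k, t k = x := fun x hx => by
    have : x ∈ Set.range t := by rw [Finset.range_orderEmbOfFin]; exact hx
    exact this
  refine ⟨m, t, t.monotone, fun i j hij => hs (i, j) ?_⟩
  have hint : ∀ i (x y : Set.Icc (0 : ℝ) T), IntervalIntegrable (f i) volume x y := fun i x y =>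
    ((intervalIntegrable_iff_integrableOn_Icc_of_le hT).2 (hf i)).mono_set (by
      rw [Set.uIcc_of_le hT]; exact Set.uIcc_subset_Icc x.2 y.2)
  let D : Fin (m + 1) → ℝ := fun k => (∫ u in (0 : ℝ)..t k, f i u) - ∫ u in (0 : ℝ)..t k, f j u
  have hD : ∀ k, D k = D 0 := by
    intro k
    induction k using Fin.induction with
    | zero => rfl
    | succ k ih =>
      rw [← ih]
      have hi := intervalIntegral.integral_add_adjacent_intervals (hint i zero (t k.castSucc))
        (hint i (t k.castSucc) (t k.succ))
      have hj := intervalIntegral.integral_add_adjacent_intervals (hint j zero (t k.castSucc))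
        (hint j (t k.castSucc) (t k.succ))
      have hk := congrFun hij k
      simp only [increments] at hk
      simp only [D]
      change _ + _ = ∫ u in (0 : ℝ)..t k.succ, f i u at hi
      change _ + _ = ∫ u in (0 : ℝ)..t k.succ, f j u at hj
      rw [← hi, ← hj, hk]
      change _ = (∫ u in (zero : ℝ)..t k.castSucc, f i u) - ∫ u in (zero : ℝ)..t k.castSucc, f j u
      ring
  obtain ⟨k₀, hk₀⟩ := hrange zero (Finset.mem_insert_self _ _)
  obtain ⟨k, hk⟩ := hrange (s (i, j))
    (Finset.mem_insert_of_mem (Finset.mem_image_of_mem _ (Finset.mem_univ _)))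
  have h₀ : D k₀ = 0 := by simp [D, hk₀, zero]
  have h₁ : D k = 0 := by rw [hD, ← hD k₀, h₀]
  rw [← hk]
  exact sub_eq_zero.1 h₁

/-! ### Independence of exponential characters -/

/-- The character `w ↦ exp (∑ᵢ wᵢ vᵢ)` of the additive monoid `ι → ℕ`. -/
noncomputable def expHom {ι : Type*} [Fintype ι] (v : ι → ℝ) : Multiplicative (ι → ℕ) →* ℝ where
  toFun w := Real.exp (∑ i, (w.toAdd i : ℝ) * v i)
  map_one' := by simp
  map_mul' w w' := by
    simp [← Real.exp_add, ← Finset.sum_add_distrib, add_mul]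

lemma expHom_injective {ι : Type*} [Fintype ι] :
    Function.Injective (expHom : (ι → ℝ) → Multiplicative (ι → ℕ) →* ℝ) := by
  classical
  intro v v' h
  funext i
  have := DFunLike.congr_fun h (Multiplicative.ofAdd (Pi.single i 1))
  simpa [expHom, Pi.single_apply] using this

/-- Finite mixtures of exponentials determine their mixing measure. -/
lemma sum_fiber_eq_of_sum_exp_eq {ι I J : Type*} [Fintype ι] [Fintype I] [Fintype J]
    [DecidableEq (ι → ℝ)] (p : I → ℝ) (v : I → ι → ℝ) (p' : J → ℝ) (v' : J → ι → ℝ)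
    (h : ∀ w : ι → ℕ, ∑ i, p i * Real.exp (∑ x, (w x : ℝ) * v i x) =
      ∑ j, p' j * Real.exp (∑ x, (w x : ℝ) * v' j x)) (c : ι → ℝ) :
    ∑ i with v i = c, p i = ∑ j with v' j = c, p' j := by
  have hli := (linearIndependent_monoidHom (Multiplicative (ι → ℕ)) ℝ).comp _ expHom_injective
  -- The difference of the two mixing measures, as a finitely supported function on exponents, is a
  -- vanishing combination of characters.
  have := linearIndependent_iff.1 hli
    (∑ i, Finsupp.single (v i) (p i) - ∑ j, Finsupp.single (v' j) (p' j)) (by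
      rw [map_sub, map_sum, map_sum, sub_eq_zero]
      funext w
      simpa [Finsupp.linearCombination_single, Finset.sum_apply, expHom] using h w.toAdd)
  have hc := DFunLike.congr_fun this c
  simpa [Finsupp.finsetSum_apply, Finsupp.single_apply, sub_eq_zero, Finset.sum_filter] using hc

/-! ### Generating functions of the increments -/

/-- The probability generating function of the Poisson distribution. -/
lemma lintegral_pow_poissonMeasure (r : NNReal) (w : ℕ) :
    ∫⁻ n, (1 + w : ENNReal) ^ n ∂poissonMeasure r = ENNReal.ofReal (Real.exp (w * r)) := by
  have hw : (1 + w : ENNReal) = ENNReal.ofReal (1 + w) := by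
    rw [ENNReal.ofReal_add zero_le_one (Nat.cast_nonneg w)]; simp
  have hs := ((NormedSpace.expSeries_div_hasSum_exp ((r : ℝ) * (1 + w))).mul_left
    (Real.exp (-r)))
  rw [poissonMeasure, lintegral_sum_measure]
  simp only [lintegral_smul_measure, lintegral_dirac, hw, smul_eq_mul]
  have : ∀ n : ℕ, ENNReal.ofReal (Real.exp (-r) * r ^ n / n.factorial) *
      ENNReal.ofReal (1 + w) ^ n =
      ENNReal.ofReal (Real.exp (-r) * (((r : ℝ) * (1 + w)) ^ n / n.factorial)) := fun n => by
    rw [← ENNReal.ofReal_pow (by positivity), ← ENNReal.ofReal_mul (by positivity)]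
    congr 1
    rw [mul_pow]
    ring
  simp only [this]
  rw [← ENNReal.ofReal_tsum_of_nonneg (fun n => by positivity) hs.summable, hs.tsum_eq,
    ← Real.exp_eq_exp_ℝ, ← Real.exp_add]
  congr 2
  ring

/-- The joint probability generating function of the increments of a Poisson process. -/
lemma IsPoissonProcess.lintegral_prod_pow {Ω : Type*} [MeasurableSpace Ω] {T : ℝ} {P : Measure Ω}
    {N : Set.Icc (0 : ℝ) T → Ω → ℕ} {a : ℝ → ℝ} (h : IsPoissonProcess P N a)
    (ha : ∀ u ∈ Set.Icc 0 T, 0 ≤ a u) {m : ℕ} {t : Fin (m + 1) → Set.Icc (0 : ℝ) T}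
    (ht : Monotone t) (w : Fin m → ℕ) :
    ∫⁻ ω, ∏ k, (1 + w k : ENNReal) ^ (N (t k.succ) ω - N (t k.castSucc) ω) ∂P =
      ENNReal.ofReal (Real.exp (∑ k, (w k : ℝ) * increments t a k)) := by
  have hind : iIndepFun (fun k ω => (1 + w k : ENNReal) ^ (N (t k.succ) ω - N (t k.castSucc) ω)) P :=
    (h.indep_increments m t ht).comp (fun k n => (1 + w k : ENNReal) ^ n)
      fun _ => Measurable.of_discrete
  have hmeas : ∀ k : Fin m, Measurable (N (t k.succ) - N (t k.castSucc)) := fun k =>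
    (h.measurable _).sub (h.measurable _)
  rw [lintegral_prod_eq_prod_lintegral_of_indepFun _ _ hind
    fun k => (Measurable.of_discrete (f := fun n : ℕ => (1 + w k : ENNReal) ^ n)).comp (hmeas k),
    Real.exp_sum, ENNReal.ofReal_prod_of_nonneg fun _ _ => (Real.exp_pos _).le]
  refine Finset.prod_congr rfl fun k _ => ?_
  have hle : t k.castSucc ≤ t k.succ := ht k.castSucc_le_succ
  have hnn : 0 ≤ increments t a k := intervalIntegral.integral_nonneg hle fun u hu =>
    ha u ⟨(t k.castSucc).2.1.trans hu.1, hu.2.trans (t k.succ).2.2⟩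
  have := lintegral_map (μ := P)
    (Measurable.of_discrete (f := fun n : ℕ => (1 + w k : ENNReal) ^ n)) (hmeas k)
  rw [h.law_increment _ _ hle, lintegral_pow_poissonMeasure] at this
  rw [← Real.coe_toNNReal _ hnn]
  exact this.symm

/-- The probability of a configuration of the labels. -/
lemma IsModel.measure_labels {Q n : ℕ} {T : ℝ} {R : Set (Fin n × Fin n)} {θ : Param Q T}
    {Ω : Type*} [MeasurableSpace Ω] {P : Measure Ω} [IsProbabilityMeasure P]
    {Z : Fin n → Ω → Fin Q} {N : R → Set.Icc (0 : ℝ) T → Ω → ℕ} (h : IsModel R θ P Z N)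
    (z : Fin n → Fin Q) :
    P {ω | ∀ i, Z i ω = z i} = ENNReal.ofReal (∏ i, θ.π (z i)) := by
  have := h.indep_Z.measure_inter_preimage_eq_mul Finset.univ (sets := fun i => {z i})
    fun i _ => measurableSet_singleton _
  have hset : {ω | ∀ i, Z i ω = z i} = ⋂ i ∈ Finset.univ, Z i ⁻¹' {z i} := by
    ext ω; simp
  rw [hset, this, ENNReal.ofReal_prod_of_nonneg fun i _ => (θ.π_pos _).le]
  refine Finset.prod_congr rfl fun i _ => ?_
  rw [← h.law_Z i (z i), measureReal_def, ENNReal.ofReal_toReal (measure_ne_top _ _)]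
  rfl

/-- The joint probability generating function, under a Poisson process stochastic block model, of
the increments of all processes along a grid. -/
lemma IsModel.lintegral_processLaw {Q n : ℕ} {T : ℝ} {R : Set (Fin n × Fin n)} [Fintype R]
    {θ : Param Q T} {Ω : Type*} [MeasurableSpace Ω] {P : Measure Ω} [IsProbabilityMeasure P]
    {Z : Fin n → Ω → Fin Q} {N : R → Set.Icc (0 : ℝ) T → Ω → ℕ} (h : IsModel R θ P Z N)
    {m : ℕ} {t : Fin (m + 1) → Set.Icc (0 : ℝ) T} (ht : Monotone t) (w : R × Fin m → ℕ) :
    ∫⁻ x, ∏ r, ∏ k, (1 + w (r, k) : ENNReal) ^ (x r (t k.succ) - x r (t k.castSucc))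
        ∂processLaw P N =
      ENNReal.ofReal (∑ z : Fin n → Fin Q, (∏ i, θ.π (z i)) * Real.exp (∑ x : R × Fin m,
        (w x : ℝ) * increments t (θ.α (z x.1.1.1) (z x.1.1.2)) x.2)) := by
  let F : R → (Set.Icc (0 : ℝ) T → ℕ) → ENNReal := fun r x =>
    ∏ k, (1 + w (r, k) : ENNReal) ^ (x (t k.succ) - x (t k.castSucc))
  have hF : ∀ r, Measurable (F r) := fun r => Finset.measurable_fun_prod _ fun k _ =>
    (Measurable.of_discrete (f := fun n : ℕ => (1 + w (r, k) : ENNReal) ^ n)).comp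
      ((measurable_pi_apply _).sub (measurable_pi_apply _))
  have hN : ∀ r, Measurable fun ω t => N r t ω := fun r =>
    measurable_pi_lambda _ fun t => h.measurable_N r t
  have hlaw : ∫⁻ x, ∏ r, F r (x r) ∂processLaw P N = ∫⁻ ω, ∏ r, F r (fun t => N r t ω) ∂P :=
    lintegral_map (Finset.measurable_fun_prod _ fun r _ => (hF r).comp (measurable_pi_apply r))
      (measurable_pi_lambda _ hN)
  have hcond : ∀ z : Fin n → Fin Q,
      ∫⁻ ω, ∏ r, F r (fun t => N r t ω) ∂P[|{ω | ∀ i, Z i ω = z i}] =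
      ENNReal.ofReal (Real.exp (∑ x : R × Fin m,
        (w x : ℝ) * increments t (θ.α (z x.1.1.1) (z x.1.1.2)) x.2)) := fun z => by
    rw [lintegral_prod_eq_prod_lintegral_of_indepFun _ (fun r ω => F r (fun t => N r t ω))
      ((h.cond_indep z).comp F hF) fun r => (hF r).comp (hN r), Fintype.sum_prod_type,
      Real.exp_sum, ENNReal.ofReal_prod_of_nonneg fun _ _ => (Real.exp_pos _).le]
    exact Finset.prod_congr rfl fun r _ =>
      (h.cond_poisson z r).lintegral_prod_pow (θ.α_nonneg _ _) ht fun k => w (r, k)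
  -- `P` is the mixture of its conditional laws given the label vector.
  have htot := sum_meas_smul_cond_fiber (X := fun ω i => Z i ω)
    (measurable_pi_lambda _ h.measurable_Z) P
  have hfib : ∀ z : Fin n → Fin Q,
      (fun ω i => Z i ω) ⁻¹' {z} = {ω | ∀ i, Z i ω = z i} := fun z => by
    ext ω; simp [funext_iff]
  simp only [hfib] at htot
  have hnn : ∀ z : Fin n → Fin Q, 0 ≤ ∏ i, θ.π (z i) := fun z =>
    Finset.prod_nonneg fun i _ => (θ.π_pos _).le
  refine hlaw.trans ?_
  conv_lhs => rw [← htot]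
  rw [lintegral_finsetSum_measure,
    ENNReal.ofReal_sum_of_nonneg fun z _ => mul_nonneg (hnn z) (Real.exp_pos _).le]
  refine Finset.sum_congr rfl fun z _ => ?_
  rw [lintegral_smul_measure, hcond, h.measure_labels, ENNReal.ofReal_mul (hnn z), smul_eq_mul]

/-! ### Recovery of the labels from the connections -/

/-- The values of `a` determine the unordered pair of their arguments. -/
def SeparatesPairs {K C : Type*} (a : K → K → C) : Prop :=
  ∀ q l q' l', a q l = a q' l' → s(q, l) = s(q', l')

open Classical in
/-- The labellings with weights `p` and connection `a`, and those with weights `p'` and connection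
`a'`, induce the same distribution of the connections between the dyads in `R`. -/
def SameConnectionLaw {K C : Type*} {n : ℕ} [Fintype K] (R : Set (Fin n × Fin n))
    (p p' : K → ℝ) (a a' : K → K → C) : Prop :=
  ∀ c : R → C,
    ∑ z : Fin n → K with ∀ r : R, a (z r.1.1) (z r.1.2) = c r, ∏ i, p (z i) =
      ∑ z : Fin n → K with ∀ r : R, a' (z r.1.1) (z r.1.2) = c r, ∏ i, p' (z i)

/-- The connection pattern of `z` has positive mass under `p`, hence nonzero mass under `p'`, so
some labelling realises it through `a'`. -/
lemma SameConnectionLaw.exists_labels {K C : Type*} {n : ℕ} [Fintype K] {R : Set (Fin n × Fin n)}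
    {p p' : K → ℝ} {a a' : K → K → C} (h : SameConnectionLaw R p p' a a') (hp : ∀ q, 0 < p q)
    (z : Fin n → K) : ∃ z' : Fin n → K, ∀ i j, (i, j) ∈ R → a (z i) (z j) = a' (z' i) (z' j) := by
  classical
  have hpos : 0 < ∑ y : Fin n → K with ∀ r : R, a (y r.1.1) (y r.1.2) = a (z r.1.1) (z r.1.2),
      ∏ i, p (y i) :=
    Finset.sum_pos (fun y _ => Finset.prod_pos fun i _ => hp _) ⟨z, by simp⟩
  have heq := h fun r => a (z r.1.1) (z r.1.2)
  have hne : ∑ y : Fin n → K with ∀ r : R, a' (y r.1.1) (y r.1.2) = a (z r.1.1) (z r.1.2),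
      ∏ i, p' (y i) ≠ 0 := by
    refine ne_of_gt (lt_of_lt_of_eq hpos ?_)
    convert heq
  obtain ⟨z', hz', -⟩ := Finset.exists_ne_zero_of_sum_ne_zero hne
  exact ⟨z', fun i j hij => ((Finset.mem_filter.1 hz').2 ⟨(i, j), hij⟩).symm⟩

/-- If the pairs of labels are determined by the connections, then the distribution of the
connections determines the weights and the connections up to label switching. -/
lemma SameConnectionLaw.exists_perm {K C : Type*} {n : ℕ} [Fintype K] (hn : 3 ≤ n)
    {R : Set (Fin n × Fin n)} (hR : ∀ i j, i < j → (i, j) ∈ R)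
    {p p' : K → ℝ} {a a' : K → K → C} (h : SameConnectionLaw R p p' a a') (hp : ∀ q, 0 < p q)
    (hp' : ∀ q, 0 < p' q) (ha : SeparatesPairs a) (ha' : SeparatesPairs a') :
    ∃ σ : Equiv.Perm K, (∀ q, p q = p' (σ q)) ∧ ∀ q l, a q l = a' (σ q) (σ l) := by
  classical
  let i₀ : Fin n := ⟨0, by omega⟩
  let i₁ : Fin n := ⟨1, by omega⟩
  let i₂ : Fin n := ⟨2, by omega⟩
  have h₀₁ : (i₀, i₁) ∈ R := hR _ _ (by simp [i₀, i₁])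
  have h₀₂ : (i₀, i₂) ∈ R := hR _ _ (by simp [i₀, i₂])
  have h₁₂ : (i₁, i₂) ∈ R := hR _ _ (by simp [i₁, i₂])
  have hdiag : ∀ q, ∃ q', a q q = a' q' q' := by
    intro q
    -- The three pairs formed by `z i₀`, `z i₁`, `z i₂` have the same connection, so they coincide
    -- as unordered pairs, which forces the three labels to be equal.
    obtain ⟨z, hz⟩ := h.exists_labels hp fun _ => q
    have e₁ := ha' _ _ _ _ ((hz _ _ h₀₁).symm.trans (hz _ _ h₀₂))
    have e₂ := ha' _ _ _ _ ((hz _ _ h₀₁).symm.trans (hz _ _ h₁₂))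
    refine ⟨z i₀, ?_⟩
    have : z i₁ = z i₀ := by
      simp only [Sym2.eq_iff] at e₁ e₂
      grind
    have := hz _ _ h₀₁
    simp_all
  choose σ hσ using hdiag
  have hinj : Function.Injective σ := fun q l hql => by
    have := ha q q l l (by rw [hσ, hσ, hql])
    simpa using this
  have hoff : ∀ q l, a q l = a' (σ q) (σ l) := by
    intro q l
    by_cases hql : q = l
    · rw [← hql, hσ]
    -- On the three individuals the patterns are `q q l` and `q l l`. The repeated label gives `y i₁
    -- = σ q` and `z i₁ = σ l`. The dyads connected by `a q l` then give `{y i₁, y i₂} = {z i₀, z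
    -- i₁}`, hence `y i₂ = σ l`, with the orientation fixed.
    obtain ⟨y, hy⟩ := h.exists_labels hp fun i => if i = i₂ then l else q
    obtain ⟨z, hz⟩ := h.exists_labels hp fun i => if i = i₀ then q else l
    have ey := hy _ _ h₀₁
    have ey' := hy _ _ h₁₂
    have ez := hz _ _ h₁₂
    have ez' := hz _ _ h₀₁
    simp only [i₀, i₁, i₂, Fin.mk.injEq, OfNat.ofNat_ne_zero, one_ne_zero,
      OfNat.zero_ne_ofNat, OfNat.one_ne_ofNat, if_true, if_false] at ey ey' ez ez'
    have sy := ha' _ _ _ _ ((hσ q).symm.trans ey)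
    have sz := ha' _ _ _ _ ((hσ l).symm.trans ez)
    have s := ha' _ _ _ _ (ey'.symm.trans ez')
    have hne : σ q ≠ σ l := hinj.ne hql
    simp only [Sym2.eq_iff] at sy sz s
    have k₁ : y ⟨1, by omega⟩ = σ q := by grind
    have k₂ : y ⟨2, by omega⟩ = σ l := by grind
    rw [ey', k₁, k₂]
  -- The pattern constantly equal to `b q q` comes from a single labelling, so comparing its mass on
  -- both sides compares `n`-th powers of weights.
  have hconst : ∀ (b : K → K → C), SeparatesPairs b → ∀ (q : K) (z : Fin n → K),
      (∀ r : R, b (z r.1.1) (z r.1.2) = b q q) ↔ z = fun _ => q := by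
    intro b hb q z
    refine ⟨fun hz => funext fun i => ?_, fun hz r => by rw [hz]⟩
    rcases eq_or_ne i i₀ with rfl | hi
    · have := hb _ _ _ _ (hz ⟨_, h₀₁⟩)
      simp only [Sym2.eq_iff] at this
      grind
    · have := hb _ _ _ _ (hz ⟨(i₀, i), hR _ _ (Fin.lt_def.2 (Nat.pos_of_ne_zero fun h0 =>
        hi (Fin.ext h0)))⟩)
      simp only [Sym2.eq_iff] at this
      grind
  refine ⟨Equiv.ofBijective σ (Finite.injective_iff_bijective.1 hinj), fun q => ?_, hoff⟩
  have hq := h fun _ => a q q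
  have hq' : ∀ z : Fin n → K, (∀ r : R, a' (z r.1.1) (z r.1.2) = a q q) ↔ z = fun _ => σ q := by
    rw [hσ q]
    exact hconst a' ha' (σ q)
  simp only [hconst a ha, hq', Finset.sum_filter, Finset.sum_ite_eq',
    Finset.mem_univ, if_true, Finset.prod_const, Finset.card_univ, Fintype.card_fin] at hq
  exact (pow_left_inj₀ (hp q).le (hp' _).le (by omega)).1 hq

/-- The law of the multivariate counting process determines the distribution of the intensities
along the dyads, for intensities observed through their increments along a grid. -/
lemma IsModel.sameConnectionLaw {Q n : ℕ} {T : ℝ} {R : Set (Fin n × Fin n)}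
    {θ θ' : Param Q T} {Ω Ω' : Type*} [MeasurableSpace Ω] [MeasurableSpace Ω']
    {P : Measure Ω} {P' : Measure Ω'} [IsProbabilityMeasure P] [IsProbabilityMeasure P']
    {Z : Fin n → Ω → Fin Q} {Z' : Fin n → Ω' → Fin Q}
    {N : R → Set.Icc (0 : ℝ) T → Ω → ℕ} {N' : R → Set.Icc (0 : ℝ) T → Ω' → ℕ}
    (h : IsModel R θ P Z N) (h' : IsModel R θ' P' Z' N') (hPP' : processLaw P N = processLaw P' N')
    {m : ℕ} {t : Fin (m + 1) → Set.Icc (0 : ℝ) T} (ht : Monotone t) :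
    SameConnectionLaw R θ.π θ'.π (fun q l => increments t (θ.α q l))
      (fun q l => increments t (θ'.α q l)) := by
  classical
  intro c
  have key := sum_fiber_eq_of_sum_exp_eq (fun z : Fin n → Fin Q => ∏ i, θ.π (z i))
    (fun z (x : R × Fin m) => increments t (θ.α (z x.1.1.1) (z x.1.1.2)) x.2)
    (fun z : Fin n → Fin Q => ∏ i, θ'.π (z i))
    (fun z (x : R × Fin m) => increments t (θ'.α (z x.1.1.1) (z x.1.1.2)) x.2)
    (fun w => by
      have hw := h.lintegral_processLaw ht w
      rw [hPP', h'.lintegral_processLaw ht w] at hw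
      refine ((ENNReal.ofReal_eq_ofReal_iff ?_ ?_).1 hw).symm <;>
        exact Finset.sum_nonneg fun z _ => mul_nonneg
          (Finset.prod_nonneg fun i _ => (Param.π_pos _ _).le) (Real.exp_pos _).le)
    (fun x => c x.1 x.2)
  simp only [funext_iff, Prod.forall] at key ⊢
  convert key

/-! ### Transfer of separation to the second parameter -/

/-- A function on a finite type whose range contains that of an injective function on the same type
is injective. -/
lemma injective_of_range_subset {K C : Type*} [Finite K] {f g : K → C}
    (hf : Function.Injective f) (hfg : Set.range f ⊆ Set.range g) : Function.Injective g := by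
  choose φ hφ using fun k => hfg ⟨k, rfl⟩
  have hinj : Function.Injective φ := fun k l hkl => hf (by rw [← hφ, ← hφ, hkl])
  have hsurj := Finite.injective_iff_surjective.1 hinj
  intro x y hxy
  obtain ⟨k, rfl⟩ := hsurj x
  obtain ⟨l, rfl⟩ := hsurj y
  rw [hφ, hφ] at hxy
  rw [hf hxy]

lemma SameConnectionLaw.exists_pair {K C : Type*} {n : ℕ} [Fintype K] (hn : 2 ≤ n)
    {R : Set (Fin n × Fin n)} (hR : ∀ i j, i < j → (i, j) ∈ R)
    {p p' : K → ℝ} {a a' : K → K → C} (h : SameConnectionLaw R p p' a a') (hp : ∀ q, 0 < p q)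
    (q l : K) : ∃ q' l', a' q' l' = a q l := by
  classical
  obtain ⟨z, hz⟩ := h.exists_labels hp fun i : Fin n => if (i : ℕ) = 0 then q else l
  have := hz ⟨0, by omega⟩ ⟨1, by omega⟩ (hR _ _ (by simp))
  exact ⟨_, _, by simpa using this.symm⟩

/-- Every value of `a` is a value of `a'`. As `a` is injective on ordered pairs, `a'` has no room
for a coincidence. -/
lemma SameConnectionLaw.separatesPairs_of_injective {K C : Type*} {n : ℕ} [Fintype K] (hn : 2 ≤ n)
    {R : Set (Fin n × Fin n)} (hR : ∀ i j, i < j → (i, j) ∈ R)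
    {p p' : K → ℝ} {a a' : K → K → C} (h : SameConnectionLaw R p p' a a') (hp : ∀ q, 0 < p q)
    (ha : ∀ q l q' l', a q l = a q' l' → q = q' ∧ l = l') : SeparatesPairs a' := by
  have hinj : Function.Injective (Function.uncurry a') := by
    refine injective_of_range_subset (f := Function.uncurry a)
      (fun x y hxy => Prod.ext_iff.2 (ha _ _ _ _ hxy)) ?_
    rintro _ ⟨⟨q, l⟩, rfl⟩
    obtain ⟨q', l', h'⟩ := h.exists_pair hn hR hp q l
    exact ⟨(q', l'), h'⟩
  intro q l q' l' hql
  have := @hinj (q, l) (q', l') hql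
  simp_all

/-- The same counting, on unordered pairs, to which symmetric connections descend. -/
lemma SameConnectionLaw.separatesPairs_of_symm {K C : Type*} {n : ℕ} [Fintype K] (hn : 2 ≤ n)
    {R : Set (Fin n × Fin n)} (hR : ∀ i j, i < j → (i, j) ∈ R)
    {p p' : K → ℝ} {a a' : K → K → C} (h : SameConnectionLaw R p p' a a') (hp : ∀ q, 0 < p q)
    (hsymm : ∀ q l, a q l = a l q) (hsymm' : ∀ q l, a' q l = a' l q) (ha : SeparatesPairs a) :
    SeparatesPairs a' := by
  have hinj : Function.Injective (Sym2.lift ⟨a', hsymm'⟩) := by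
    refine injective_of_range_subset (f := Sym2.lift ⟨a, hsymm⟩) ?_ ?_
    · rintro ⟨q, l⟩ ⟨q', l'⟩ hql
      exact ha _ _ _ _ hql
    · rintro _ ⟨⟨q, l⟩, rfl⟩
      obtain ⟨q', l', h'⟩ := h.exists_pair hn hR hp q l
      exact ⟨s(q', l'), h'⟩
  exact fun q l q' l' hql => @hinj s(q, l) s(q', l') hql

/-! ### Identifiability in both setups -/

/-- A parameter is identifiable if every injective observation `f` of its intensities determines the
pairs of labels, both for it and for the parameters inducing the same connection law. -/
lemma identifiable_of_separatesPairs.{u, v} {Q n : ℕ} {T : ℝ} (hT : 0 ≤ T) (hn : 3 ≤ n)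
    {R : Set (Fin n × Fin n)} (hR : ∀ i j, i < j → (i, j) ∈ R) {C : Set (Param Q T)}
    {θ : Param Q T}
    (hsep : ∀ θ' ∈ C, ∀ (V : Type) (f : (ℝ → ℝ) → V),
      (∀ q l q' l', f (θ.α q l) = f (θ.α q' l') → AEEqOn T (θ.α q l) (θ.α q' l')) →
      SameConnectionLaw R θ.π θ'.π (fun q l => f (θ.α q l)) (fun q l => f (θ'.α q l)) →
      SeparatesPairs (fun q l => f (θ.α q l)) ∧ SeparatesPairs fun q l => f (θ'.α q l)) :
    Identifiable.{u, v} R C θ := by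
  intro θ' hθ' Ω Ω' _ _ P P' _ _ Z Z' N N' h h' hPP'
  -- One grid serves both families, so that equal increments across `θ` and `θ'` also yield almost
  -- everywhere equality.
  obtain ⟨m, t, ht, hgrid⟩ := exists_separating_grid hT
    (Sum.elim (fun x : Fin Q × Fin Q => θ.α x.1 x.2) fun x : Fin Q × Fin Q => θ'.α x.1 x.2)
    (by rintro (x | x); exacts [θ.α_integrable _ _, θ'.α_integrable _ _])
  have hlaw := h.sameConnectionLaw h' hPP' ht
  obtain ⟨ha, ha'⟩ := hsep θ' hθ' _ (increments t)
    (fun q l q' l' => hgrid (.inl (q, l)) (.inl (q', l'))) hlaw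
  obtain ⟨σ, hσ, hσ'⟩ := hlaw.exists_perm hn hR θ.π_pos θ'.π_pos ha ha'
  exact ⟨σ, hσ, fun q l => hgrid (.inl (q, l)) (.inr (σ q, σ l)) (hσ' q l)⟩

end PPSBM

theorem proposition1 {Q n : ℕ} {T : ℝ} (hT : 0 < T) (hn : 3 ≤ n) (θ : PPSBM.Param Q T) :
    (θ.DistinctDirected →
      PPSBM.Identifiable (PPSBM.directedDyads n) Set.univ θ) ∧
    (θ.IsSymm → θ.DistinctUndirected →
      PPSBM.Identifiable (PPSBM.undirectedDyads n) {θ' | θ'.IsSymm} θ) := by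
  have hR : ∀ i j : Fin n, i < j → (i, j) ∈ PPSBM.directedDyads n := fun i j hij => hij.ne
  have hR' : ∀ i j : Fin n, i < j → (i, j) ∈ PPSBM.undirectedDyads n := fun i j hij => hij
  refine ⟨fun hθ => ?_, fun hsymm hθ => ?_⟩
  · refine PPSBM.identifiable_of_separatesPairs hT.le hn hR fun θ' _ V f hf hlaw => ?_
    have ha : ∀ q l q' l', f (θ.α q l) = f (θ.α q' l') → q = q' ∧ l = l' :=
      fun q l q' l' hql => hθ q l q' l' (hf q l q' l' hql)
    refine ⟨fun q l q' l' hql => ?_, hlaw.separatesPairs_of_injective (by omega) hR θ.π_pos ha⟩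
    rw [(ha q l q' l' hql).1, (ha q l q' l' hql).2]
  · refine PPSBM.identifiable_of_separatesPairs hT.le hn hR' fun θ' hsymm' V f hf hlaw => ?_
    have ha : PPSBM.SeparatesPairs fun q l => f (θ.α q l) := by
      intro q l q' l' hql
      -- Distinctness is assumed only for ordered indices, so both pairs are sorted by symmetry
      -- before it is applied.
      obtain ⟨i, j, hij, hs, hα⟩ : ∃ i j, i ≤ j ∧ s(q, l) = s(i, j) ∧ θ.α q l = θ.α i j := by
        rcases le_total q l with h | h
        exacts [⟨q, l, h, rfl, rfl⟩, ⟨l, q, h, Sym2.eq_swap, hsymm q l⟩]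
      obtain ⟨i', j', hij', hs', hα'⟩ :
          ∃ i j, i ≤ j ∧ s(q', l') = s(i, j) ∧ θ.α q' l' = θ.α i j := by
        rcases le_total q' l' with h | h
        exacts [⟨q', l', h, rfl, rfl⟩, ⟨l', q', h, Sym2.eq_swap, hsymm q' l'⟩]
      have := hf q l q' l' hql
      rw [hα, hα'] at this
      obtain ⟨h₁, h₂⟩ := hθ _ _ _ _ hij hij' this
      rw [hs, hs', h₁, h₂]
    exact ⟨ha, hlaw.separatesPairs_of_symm (by omega) hR' θ.π_pos
      (fun q l => congrArg f (hsymm q l)) (fun q l => congrArg f (hsymm' q l)) ha⟩
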